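/- Fix infinite sets $\mathcal X$ (alternatives) and $\mathcal V$ (voters). A \emph{profile} $\mathbf P$ assigns to each voter $i$ in a nonempty finite set $V(\mathbf P)\subseteq\mathcal V$ a strict weak order $\mathbf P(i)$ on a nonempty finite set $X(\mathbf P)\subseteq\mathcal X$; it is \emph{linear} if every $\mathbf P(i)$ is a linear order. Let $\mathrm{Margin}_{\mathbf P}(x,y)=|\{i\in V(\mathbf P): (x,y)\in\mathbf P(i)\}|-|\{i\in V(\mathbf P): (y,x)\in\mathbf P(i)\}|$. The \emph{ordinal margin graph} $\mathbb M(\mathbf P)=(M,\succ)$ consists of the directed graph $M$ with vertex set $X(\mathbf P)$ and an edge from $x$ to $y$ when $\mathrm{Margin}_{\mathbf P}(x,y)>0$, and of the strict weak order $\succ$ on the edges of $M$ with $(a,b)\succ(c,d)$ if and only if $\mathrm{Margin}_{\mathbf P}(a,b)>\mathrm{Margin}_{\mathbf P}(c,d)$. A \emph{linearly edge-ordered tournament} is a pair $(M,\succ)$ where $M$ is an asymmetric directed graph in which any two distinct vertices are joined by an edge in some direction and $\succ$ is a linear order of the edges of $M$. A \emph{voting method} $F$ assigns to each profile $\mathbf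 P$ a nonempty set $F(\mathbf P)\subseteq X(\mathbf P)$. It satisfies \begin{itemize} \item \emph{ordinal margin invariance} if $F(\mathbf P)=F(\mathbf P')$ for all profiles $\mathbf P,\mathbf P'$ with $\mathbb M(\mathbf P)=\mathbb M(\mathbf P')$; \item \emph{single-voter resolvability} if for every profile $\mathbf P$ with $|F(\mathbf P)|>1$ there is a profile $\mathbf P'$ obtained from $\mathbf P$ by adding exactly one new voter such that $|F(\mathbf P')|=1$; \item \emph{asymptotic resolvability} if for every positive integer $m$ and every set $A\subseteq\mathcal X$ of $m$ alternatives, the proportion of profiles $\mathbf P$ with $|F(\mathbf P)|>1$ among the linear profiles with set of alternatives $A$ and set of voters $V$ tends to $0$ as $|V|\to\infty$ ($V\subseteq\mathcal V$ finite). \end{itemize} \textbf{Lemma.} Let $F$ be a voting method satisfying ordinal margin invariance. If $F$ satisfies single-voter resolvability, then $|F(\mathbf P)|=1$ for every profile $\mathbf P$ whose ordinal margin graph is a linearly edge-ordered tournament. The same conclusion holds if $F$ satisfies asymptotic resolvability instead of single-voter resolvability. -/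

import Mathlib

open Filter Topology

namespace SocialChoice

/-- `r` is a strict weak order on the set `s` (a set of pairs of elements of `s` that is
asymmetric and negatively transitive). -/
structure IsStrictWeakOrderOn {α : Type*} (s : Set α) (r : α → α → Prop) : Prop where
  mem : ∀ x y, r x y → x ∈ s ∧ y ∈ s
  asymm : ∀ x y, r x y → ¬ r y x
  neg_trans : ∀ x y z, z ∈ s → r x y → r x z ∨ r z y

/-- `r` is a (strict) linear order on the set `s`. -/
structure IsStrictLinearOrderOn {α : Type*} (s : Set α) (r : α → α → Prop) : Prop where
  mem : ∀ x y, r x y → x ∈ s ∧ y ∈ s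
  irrefl : ∀ x, ¬ r x x
  trans : ∀ x y z, r x y → r y z → r x z
  total : ∀ x ∈ s, ∀ y ∈ s, x ≠ y → r x y ∨ r y x

/-- A profile: a nonempty finite set of voters, a nonempty finite set of alternatives, and for
each voter a strict weak order on the alternatives. `pref i x y` means that voter `i` strictly
prefers `x` to `y`; it is false when `i` is not a voter, so that a profile is determined by the
ballots of its voters. -/
@[ext]
structure Profile (𝓥 𝓧 : Type*) where
  voters : Finset 𝓥
  alts : Finset 𝓧
  pref : 𝓥 → 𝓧 → 𝓧 → Prop
  voters_nonempty : voters.Nonempty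
  alts_nonempty : alts.Nonempty
  pref_weak : ∀ i ∈ voters, IsStrictWeakOrderOn (alts : Set 𝓧) (pref i)
  pref_off : ∀ i, i ∉ voters → ∀ x y, ¬ pref i x y

/-- A directed graph on a finite set of vertices, with a relation `succ` between its edges. -/
@[ext]
structure EdgeOrderedGraph (𝓧 : Type*) where
  verts : Finset 𝓧
  edges : Set (𝓧 × 𝓧)
  succ : 𝓧 × 𝓧 → 𝓧 × 𝓧 → Prop

/-- A linearly edge-ordered tournament: an asymmetric directed graph in which any two distinct
vertices are joined by an edge in some direction, with a linear order of its edges. -/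
structure EdgeOrderedGraph.IsLinearlyEdgeOrderedTournament {𝓧 : Type*}
    (G : EdgeOrderedGraph 𝓧) : Prop where
  edges_mem : ∀ x y, (x, y) ∈ G.edges → x ∈ G.verts ∧ y ∈ G.verts
  asymm : ∀ x y, (x, y) ∈ G.edges → (y, x) ∉ G.edges
  complete : ∀ x ∈ G.verts, ∀ y ∈ G.verts, x ≠ y → (x, y) ∈ G.edges ∨ (y, x) ∈ G.edges
  linear : IsStrictLinearOrderOn G.edges G.succ

namespace Profile

variable {𝓥 𝓧 : Type*}

/-- All ballots are linear orders. -/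
def IsLinear (P : Profile 𝓥 𝓧) : Prop :=
  ∀ i ∈ P.voters, IsStrictLinearOrderOn (P.alts : Set 𝓧) (P.pref i)

open Classical in
/-- The number of voters who strictly prefer `x` to `y`. -/
noncomputable def support (P : Profile 𝓥 𝓧) (x y : 𝓧) : ℕ :=
  (P.voters.filter fun i => P.pref i x y).card

/-- The margin of `x` over `y`. -/
noncomputable def margin (P : Profile 𝓥 𝓧) (x y : 𝓧) : ℤ :=
  (P.support x y : ℤ) - (P.support y x : ℤ)

/-- The ordinal margin graph: an edge from `x` to `y` when the margin of `x` over `y` is positive,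
and edges ordered by the size of their margins. -/
noncomputable def ordinalMarginGraph (P : Profile 𝓥 𝓧) : EdgeOrderedGraph 𝓧 where
  verts := P.alts
  edges := {e | e.1 ∈ P.alts ∧ e.2 ∈ P.alts ∧ 0 < P.margin e.1 e.2}
  succ e f :=
    (e.1 ∈ P.alts ∧ e.2 ∈ P.alts ∧ 0 < P.margin e.1 e.2) ∧
    (f.1 ∈ P.alts ∧ f.2 ∈ P.alts ∧ 0 < P.margin f.1 f.2) ∧
    P.margin f.1 f.2 < P.margin e.1 e.2

/-- `P'` is obtained from `P` by adding exactly one new voter (with an arbitrary ballot). -/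
def AddsOneVoter (P P' : Profile 𝓥 𝓧) : Prop :=
  P'.alts = P.alts ∧
  (∃ (i : 𝓥) (hi : i ∉ P.voters), P'.voters = P.voters.cons i hi) ∧
  ∀ j ∈ P.voters, P'.pref j = P.pref j

/-- The linear profiles with set of voters `V` and set of alternatives `A`. -/
def linearProfiles (V : Finset 𝓥) (A : Finset 𝓧) : Set (Profile 𝓥 𝓧) :=
  {P | P.voters = V ∧ P.alts = A ∧ P.IsLinear}

theorem finite_linearProfiles (V : Finset 𝓥) (A : Finset 𝓧) :
    (linearProfiles V A).Finite := by
  refine Set.Finite.of_injOn (f := fun (P : Profile 𝓥 𝓧) (i : V) (x y : A) => P.pref i x y)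
    (t := Set.univ) (fun _ _ => Set.mem_univ _) ?_ Set.finite_univ
  rintro P ⟨hPV, hPA, -⟩ Q ⟨hQV, hQA, -⟩ h
  refine Profile.ext (hPV.trans hQV.symm) (hPA.trans hQA.symm) ?_
  funext i x y
  by_cases hi : i ∈ V
  · by_cases hxy : x ∈ A ∧ y ∈ A
    · exact congrFun (congrFun (congrFun h ⟨i, hi⟩) ⟨x, hxy.1⟩) ⟨y, hxy.2⟩
    · have h1 : ¬ P.pref i x y := fun hp => hxy (by
        simpa [hPA] using (P.pref_weak i (hPV ▸ hi)).mem x y hp)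
      have h2 : ¬ Q.pref i x y := fun hp => hxy (by
        simpa [hQA] using (Q.pref_weak i (hQV ▸ hi)).mem x y hp)
      simp [h1, h2]
  · simp [P.pref_off i (hPV ▸ hi), Q.pref_off i (hQV ▸ hi)]

end Profile

/-- A voting method assigns to each profile a nonempty set of its alternatives. -/
structure VotingMethod (𝓥 𝓧 : Type*) where
  winners : Profile 𝓥 𝓧 → Finset 𝓧
  winners_nonempty : ∀ P, (winners P).Nonempty
  winners_subset : ∀ P, winners P ⊆ P.alts

namespace VotingMethod

variable {𝓥 𝓧 : Type*}

/-- The winners depend only on the ordinal margin graph. -/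
def OrdinalMarginInvariant (F : VotingMethod 𝓥 𝓧) : Prop :=
  ∀ P P' : Profile 𝓥 𝓧, P.ordinalMarginGraph = P'.ordinalMarginGraph → F.winners P = F.winners P'

/-- Every tie can be broken by adding just one new voter. -/
def SingleVoterResolvable (F : VotingMethod 𝓥 𝓧) : Prop :=
  ∀ P : Profile 𝓥 𝓧, 1 < (F.winners P).card →
    ∃ P' : Profile 𝓥 𝓧, P.AddsOneVoter P' ∧ (F.winners P').card = 1

/-- The proportion of the linear profiles with voters `V` and alternatives `A` in which `F` selects
more than one winner. -/
noncomputable def tieProportion (F : VotingMethod 𝓥 𝓧) (V : Finset 𝓥) (A : Finset 𝓧) : ℝ :=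
  ({P ∈ Profile.linearProfiles V A | 1 < (F.winners P).card}.ncard : ℝ) /
    ((Profile.linearProfiles V A).ncard : ℝ)

/-- For any positive number `m` of alternatives (and any set of `m` alternatives), the proportion
of linear profiles with more than one winner tends to zero as the number of voters tends to
infinity; the filter is that of finite sets `V` of voters with `V.card → ∞`. -/
def AsymptoticallyResolvable (F : VotingMethod 𝓥 𝓧) : Prop :=
  ∀ m : ℕ, 0 < m → ∀ A : Finset 𝓧, A.card = m →
    Tendsto (fun V : Finset 𝓥 => F.tieProportion V A) (comap Finset.card atTop) (𝓝 0)

end VotingMethod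

end SocialChoice

namespace SocialChoice

/-! ### Product measures and a change of measure. -/

section Tilting

variable {ι L : Type*} [Fintype ι] [DecidableEq ι] [Fintype L]

/-! In a linearly edge-ordered tournament the margins are integers, nonzero between distinct
alternatives, and distinct edges have margins at least 1 apart. So a profile on the same
alternatives whose margins lie within `T / 2` of `T` times the given ones has the same ordinal
margin graph, hence the same winners (`ordinalMarginGraph_eq_of_near`).

Single-voter case: replicate the profile three times. One further voter moves each margin by at most
1, so the graph survives and no added ballot could break a tie.

Asymptotic case: it is enough that a share of the linear profiles bounded away from 0 has the given
graph (`exists_le_ncard_ordinalMarginGraph_eq`), since a tie would then recur on that share. Uniform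
random margins fluctuate on the scale `√n`. Tilting the ballot distribution by order `1 / √n` in a
suitable direction (`exists_weight`) gives them a drift of that scale, proportional to the target. A
large constant makes the drift dominate (Chebyshev), and the second moment of the density stays
bounded, so by Cauchy–Schwarz an event likely under the tilt has uniform probability bounded below
(`exists_le_card_near_drift`). -/

theorem sum_prod_apply (g : L → ℝ) :
    ∑ f : ι → L, ∏ i, g (f i) = (∑ r, g r) ^ Fintype.card ι := by
  rw [← Fintype.prod_sum (fun (_ : ι) r => g r)]
  simp

theorem sum_prod_mul_mul_of_ne (g h : L → ℝ) (hgh : ∑ r, g r * h r = 0) {i j : ι} (hij : i ≠ j) :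
    ∑ f : ι → L, (∏ l, g (f l)) * (h (f i) * h (f j)) = 0 := by
  -- Writing the extra factors as products over all coordinates lets the sum factor; the factor at
  -- `i` vanishes by centring.
  have key : ∀ f : ι → L, (∏ l, g (f l)) * (h (f i) * h (f j)) =
      ∏ l, g (f l) * ((if l = i then h (f l) else 1) * (if l = j then h (f l) else 1)) := by
    intro f
    rw [Finset.prod_mul_distrib, Finset.prod_mul_distrib]
    simp
  simp_rw [key]
  rw [← Fintype.prod_sum
    (fun (l : ι) r => g r * ((if l = i then h r else 1) * (if l = j then h r else 1)))]
  exact Finset.prod_eq_zero (Finset.mem_univ i) (by simpa [hij] using hgh)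

theorem sum_prod_mul_apply (g h : L → ℝ) (i : ι) :
    ∑ f : ι → L, (∏ l, g (f l)) * h (f i) =
      (∑ r, g r * h r) * (∑ r, g r) ^ (Fintype.card ι - 1) := by
  have key : ∀ f : ι → L, (∏ l, g (f l)) * h (f i) =
      ∏ l, g (f l) * (if l = i then h (f l) else 1) := by
    intro f
    rw [Finset.prod_mul_distrib]
    simp
  simp_rw [key]
  rw [← Fintype.prod_sum (fun (l : ι) r => g r * (if l = i then h r else 1)),
    ← Finset.mul_prod_erase _ _ (Finset.mem_univ i)]
  congr 1
  · simp
  · rw [Finset.prod_congr rfl (g := fun _ => ∑ r, g r)]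
    · simp [Finset.card_erase_of_mem]
    · intro l hl
      simp [Finset.ne_of_mem_erase hl]

/-- The variance of a sum of independent centred variables, for the product of the
(unnormalised) weight `g`. -/
theorem sum_prod_mul_sum_sq (g h : L → ℝ) (hgh : ∑ r, g r * h r = 0) :
    ∑ f : ι → L, (∏ l, g (f l)) * (∑ i, h (f i)) ^ 2 =
      Fintype.card ι * ((∑ r, g r * h r ^ 2) * (∑ r, g r) ^ (Fintype.card ι - 1)) := by
  have expand : ∀ f : ι → L, (∏ l, g (f l)) * (∑ i, h (f i)) ^ 2 =
      ∑ i, ∑ j, (∏ l, g (f l)) * (h (f i) * h (f j)) := by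
    intro f
    rw [sq, Finset.sum_mul_sum, Finset.mul_sum]
    simp_rw [Finset.mul_sum]
  simp_rw [expand]
  rw [Finset.sum_comm]
  have inner : ∀ i : ι, ∑ f : ι → L, ∑ j, (∏ l, g (f l)) * (h (f i) * h (f j)) =
      (∑ r, g r * h r ^ 2) * (∑ r, g r) ^ (Fintype.card ι - 1) := by
    intro i
    rw [Finset.sum_comm, Finset.sum_eq_single i]
    · rw [← sum_prod_mul_apply g (fun r => h r ^ 2) i]
      simp_rw [sq]
    · intro j _ hj
      exact sum_prod_mul_mul_of_ne g h hgh hj.symm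
    · simp
  simp [inner]

/-- If `u k` are bounded centred functions whose correlations with `w` are the numbers `d k`, then
for a set of samples of size bounded below the sums of `u k` over the sample are proportional to
`d k`, up to a relative error of one half. The proof compares the uniform measure with the product
measure of density proportional to `1 + ε * w`, with `ε` of order `1 / √n`. -/
theorem exists_le_card_near_drift {κ : Type*} [Fintype κ] [Nonempty L]
    (u : κ → L → ℝ) (d : κ → ℝ) (w : L → ℝ)
    (hu : ∀ k r, |u k r| ≤ 1) (hu0 : ∀ k, ∑ r, u k r = 0) (hw0 : ∑ r, w r = 0)
    (hwu : ∀ k, ∑ r, w r * u k r = Fintype.card L * d k) :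
    ∃ c : ℝ, 0 < c ∧ ∃ n₀ : ℕ, ∀ (ι : Type*) [Fintype ι], n₀ ≤ Fintype.card ι →
      ∃ T : ℝ, 0 < T ∧ c * (Fintype.card L : ℝ) ^ Fintype.card ι ≤
        {f : ι → L | ∀ k, |∑ i, u k (f i) - T * d k| < T / 2}.ncard := by
  classical
  -- Chebyshev and a union bound give failure probability at most `4 * card κ / S ^ 2`. This is at
  -- most one half because `S ≥ 1` and `S ≥ 8 * card κ`.
  set S : ℝ := 8 * Fintype.card κ + 1 with hS
  set N : ℝ := (Fintype.card L : ℝ) with hN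
  have hN0 : 0 < N := by simp [hN, Fintype.card_pos]
  have hS1 : 1 ≤ S := by simp [hS]
  have hS0 : 0 < S := by linarith
  set B : ℝ := ∑ r, |w r| with hB
  set σ : ℝ := (∑ r, w r ^ 2) / N with hσ
  -- The `1 / 4` is the square of the half mass kept by the good event. The threshold makes `ε * |w
  -- r| ≤ 1`, so the tilted weight is nonnegative; the `+ 1` excludes empty samples.
  refine ⟨Real.exp (-(S ^ 2 * σ)) / 4, by positivity, ⌈(S * B) ^ 2⌉₊ + 1, ?_⟩
  intro ι _ hn
  set n : ℕ := Fintype.card ι with hn'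
  have hn1 : 1 ≤ n := by omega
  have hnpos : (0 : ℝ) < n := by exact_mod_cast hn1
  have hsq : 0 < √(n : ℝ) := Real.sqrt_pos.2 hnpos
  have hsq2 : √(n : ℝ) ^ 2 = n := Real.sq_sqrt hnpos.le
  have hSB : S * B ≤ √(n : ℝ) := by
    apply Real.le_sqrt_of_sq_le
    refine (Nat.le_ceil _).trans ?_
    exact_mod_cast (by omega : ⌈(S * B) ^ 2⌉₊ ≤ n)
  set ε : ℝ := S / √(n : ℝ) with hε
  have hε0 : 0 < ε := by positivity
  set T : ℝ := S * √(n : ℝ) with hT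
  have hT0 : 0 < T := by positivity
  have hnε : n * ε = T := by
    rw [hε, hT]; nth_rw 1 [← hsq2]; field_simp
  have hnε2 : n * ε ^ 2 = S ^ 2 := by
    rw [hε, div_pow, hsq2]; field_simp
  set g : L → ℝ := fun r => 1 + ε * w r with hg
  have hg0 : ∀ r, 0 ≤ g r := by
    intro r
    have h1 : |w r| ≤ B := Finset.single_le_sum (f := fun r => |w r|)
      (fun _ _ => abs_nonneg _) (Finset.mem_univ r)
    have h2 : ε * |w r| ≤ 1 := by
      rw [hε, div_mul_eq_mul_div, div_le_one hsq]
      exact (mul_le_mul_of_nonneg_left h1 hS0.le).trans hSB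
    have h3 : ε * -|w r| ≤ ε * w r := mul_le_mul_of_nonneg_left (neg_abs_le _) hε0.le
    simp only [hg]; linarith
  have hgsum : ∑ r, g r = N := by
    simp [hg, Finset.sum_add_distrib, ← Finset.mul_sum, hw0, hN]
  have hgsq : ∑ r, g r ^ 2 = N * (1 + ε ^ 2 * σ) := by
    have : ∀ r, g r ^ 2 = 1 + 2 * ε * w r + ε ^ 2 * w r ^ 2 := fun r => by simp only [hg]; ring
    simp_rw [this, Finset.sum_add_distrib, ← Finset.mul_sum, hw0]
    rw [hσ]; field_simp; simp [hN]
  have hgu : ∀ k, ∑ r, g r * u k r = N * (ε * d k) := by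
    intro k
    simp only [hg, add_mul, one_mul, Finset.sum_add_distrib, mul_assoc, ← Finset.mul_sum, hu0, hwu]
    ring
  have hcent : ∀ k, ∑ r, g r * (u k r - ε * d k) = 0 := by
    intro k
    simp only [mul_sub, Finset.sum_sub_distrib, hgu, ← Finset.sum_mul, hgsum]
    ring
  -- The variance is at most the raw second moment, which is at most 1 after normalisation.
  have hvar : ∀ k, ∑ r, g r * (u k r - ε * d k) ^ 2 ≤ N := by
    intro k
    have h1 : ∀ r, g r * (u k r - ε * d k) ^ 2 ≤
        g r - 2 * (ε * d k) * (g r * u k r) + (ε * d k) ^ 2 * g r := by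
      intro r
      have : u k r ^ 2 ≤ 1 := (sq_le_one_iff_abs_le_one _).2 (hu k r)
      nlinarith [mul_le_mul_of_nonneg_left this (hg0 r)]
    refine (Finset.sum_le_sum fun r _ => h1 r).trans ?_
    simp only [Finset.sum_add_distrib, Finset.sum_sub_distrib, ← Finset.mul_sum, hgu, hgsum]
    nlinarith [mul_nonneg hN0.le (sq_nonneg (ε * d k))]
  set G : (ι → L) → ℝ := fun f => ∏ i, g (f i) with hG
  have hG0 : ∀ f, 0 ≤ G f := fun f => Finset.prod_nonneg fun i _ => hg0 _
  have hGsum : ∑ f, G f = N ^ n := by rw [hG, sum_prod_apply, hgsum]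
  -- The linear term in `ε` drops out because `w` sums to zero; what remains is `(1 + ε ^ 2 * σ) ^
  -- n`, bounded uniformly in `n` since `n * ε ^ 2 = S ^ 2`.
  have hGsq : ∑ f, G f ^ 2 ≤ N ^ n * Real.exp (S ^ 2 * σ) := by
    have : ∀ f, G f ^ 2 = ∏ i, g (f i) ^ 2 := fun f => by simp [hG, Finset.prod_pow]
    simp_rw [this]
    rw [sum_prod_apply (fun r => g r ^ 2), hgsq, mul_pow]
    refine mul_le_mul_of_nonneg_left ?_ (by positivity)
    rw [← hnε2, mul_assoc, Real.exp_nat_mul]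
    have hσ0 : 0 ≤ σ := by positivity
    refine pow_le_pow_left₀ (by positivity) ?_ _
    rw [add_comm]
    exact Real.add_one_le_exp _
  have hdev : ∀ k, ∑ f, G f * (∑ i, u k (f i) - T * d k) ^ 2 ≤ n * N ^ n := by
    intro k
    have h1 : ∀ f : ι → L, ∑ i, u k (f i) - T * d k = ∑ i, (u k (f i) - ε * d k) := by
      intro f
      rw [Finset.sum_sub_distrib, ← hnε]
      simp [hn', mul_assoc]
    simp_rw [h1, hG]
    rw [sum_prod_mul_sum_sq g (fun r => u k r - ε * d k) (hcent k), hgsum]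
    refine mul_le_mul_of_nonneg_left ?_ hnpos.le
    calc _ ≤ N * N ^ (n - 1) := mul_le_mul_of_nonneg_right (hvar k) (by positivity)
      _ = N ^ n := by rw [← pow_succ', Nat.sub_add_cancel hn1]
  set good : Finset (ι → L) :=
    Finset.univ.filter fun f => ∀ k, |∑ i, u k (f i) - T * d k| < T / 2 with hgood
  have hbad : ∑ f ∈ goodᶜ, G f ≤ N ^ n / 2 := by
    have hpt : ∀ f ∈ goodᶜ, G f * (T / 2) ^ 2 ≤
        ∑ k, G f * (∑ i, u k (f i) - T * d k) ^ 2 := by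
      intro f hf
      simp only [hgood, Finset.mem_compl, Finset.mem_filter, Finset.mem_univ, true_and,
        not_forall, not_lt] at hf
      obtain ⟨k, hk⟩ := hf
      refine le_trans ?_ (Finset.single_le_sum
        (f := fun k => G f * (∑ i, u k (f i) - T * d k) ^ 2)
        (fun k _ => mul_nonneg (hG0 f) (sq_nonneg _)) (Finset.mem_univ k))
      refine mul_le_mul_of_nonneg_left ?_ (hG0 f)
      rw [← sq_abs (∑ i, u k (f i) - T * d k)]
      exact pow_le_pow_left₀ (by positivity) hk 2
    have h1 : (∑ f ∈ goodᶜ, G f) * (T / 2) ^ 2 ≤ Fintype.card κ * (n * N ^ n) := by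
      rw [Finset.sum_mul]
      refine (Finset.sum_le_sum hpt).trans ?_
      refine (Finset.sum_le_sum_of_subset_of_nonneg (Finset.subset_univ _)
        fun f _ _ => Finset.sum_nonneg fun k _ => mul_nonneg (hG0 f) (sq_nonneg _)).trans ?_
      rw [Finset.sum_comm]
      refine (Finset.sum_le_sum fun k _ => hdev k).trans ?_
      simp
    have h2 : (Fintype.card κ : ℝ) * 8 ≤ S ^ 2 := by nlinarith
    have h3 : (T / 2) ^ 2 = S ^ 2 * n / 4 := by rw [hT, div_pow, mul_pow, hsq2]; ring
    rw [h3] at h1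
    have h4 : (0 : ℝ) < S ^ 2 * n / 4 := by positivity
    refine le_of_mul_le_mul_right (h1.trans ?_) h4
    linarith [mul_le_mul_of_nonneg_right h2 (by positivity : (0 : ℝ) ≤ n * N ^ n)]
  have hgoodG : N ^ n / 2 ≤ ∑ f ∈ good, G f := by
    have := Finset.sum_add_sum_compl good G
    linarith
  -- Cauchy–Schwarz turns tilted mass into a count of samples.
  have hcs : (∑ f ∈ good, G f) ^ 2 ≤ good.card * (N ^ n * Real.exp (S ^ 2 * σ)) := by
    refine (sq_sum_le_card_mul_sum_sq).trans ?_
    refine mul_le_mul_of_nonneg_left ?_ (Nat.cast_nonneg _)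
    exact (Finset.sum_le_sum_of_subset_of_nonneg (Finset.subset_univ _)
      fun f _ _ => sq_nonneg _).trans hGsq
  refine ⟨T, hT0, ?_⟩
  have hcard : {f : ι → L | ∀ k, |∑ i, u k (f i) - T * d k| < T / 2}.ncard = good.card := by
    rw [← Set.ncard_coe_finset]; congr 1; ext f; simp [hgood]
  rw [hcard, Real.exp_neg]
  have hNn : 0 < N ^ n := by positivity
  have hexp := Real.exp_pos (S ^ 2 * σ)
  have h5 : (N ^ n / 2) ^ 2 ≤ good.card * (N ^ n * Real.exp (S ^ 2 * σ)) :=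
    (pow_le_pow_left₀ (by positivity) hgoodG 2).trans hcs
  have h6 : N ^ n / 4 ≤ good.card * Real.exp (S ^ 2 * σ) := by
    refine le_of_mul_le_mul_right ?_ hNn
    calc N ^ n / 4 * N ^ n = (N ^ n / 2) ^ 2 := by ring
      _ ≤ _ := h5
      _ = _ := by ring
  rw [div_mul_eq_mul_div, inv_mul_eq_div, div_div, div_le_iff₀ (by positivity)]
  linarith

end Tilting

/-! ### Margins as sums over ballots, replication, and stability of the graph. -/

open Classical in
/-- The contribution of a ballot `r` to the margin of `x` over `y`. -/
noncomputable def ballotMargin {𝓧 : Type*} (r : 𝓧 → 𝓧 → Prop) (x y : 𝓧) : ℤ :=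
  (if r x y then 1 else 0) - (if r y x then 1 else 0)

theorem abs_ballotMargin_le {𝓧 : Type*} (r : 𝓧 → 𝓧 → Prop) (x y : 𝓧) :
    |ballotMargin r x y| ≤ 1 := by
  unfold ballotMargin
  split_ifs <;> simp

theorem ballotMargin_flip {𝓧 : Type*} (r : 𝓧 → 𝓧 → Prop) (x y : 𝓧) :
    ballotMargin (fun a b => r b a) x y = -ballotMargin r x y := by
  simp [ballotMargin]

namespace Profile

variable {𝓥 𝓧 : Type*}

theorem margin_eq_sum (P : Profile 𝓥 𝓧) (x y : 𝓧) :
    P.margin x y = ∑ i ∈ P.voters, ballotMargin (P.pref i) x y := by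
  classical
  simp [margin, support, ballotMargin, Finset.sum_sub_distrib, Finset.sum_boole]

theorem margin_self (P : Profile 𝓥 𝓧) (x : 𝓧) : P.margin x x = 0 := by simp [margin]

theorem margin_swap (P : Profile 𝓥 𝓧) (x y : 𝓧) : P.margin y x = -P.margin x y := by
  simp [margin]

theorem AddsOneVoter.abs_margin_sub_le {P P' : Profile 𝓥 𝓧} (h : P.AddsOneVoter P') (x y : 𝓧) :
    |P'.margin x y - P.margin x y| ≤ 1 := by
  obtain ⟨-, ⟨i, hi, hV⟩, hpref⟩ := h
  rw [margin_eq_sum, margin_eq_sum, hV, Finset.sum_cons,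
    Finset.sum_congr rfl fun j hj => by rw [hpref j hj]]
  simpa using abs_ballotMargin_le (P'.pref i) x y

/-- Every profile can be replicated `k` times. -/
theorem exists_margin_eq_mul [Infinite 𝓥] (P : Profile 𝓥 𝓧) {k : ℕ} (hk : 0 < k) :
    ∃ Q : Profile 𝓥 𝓧, Q.alts = P.alts ∧ ∀ x y, Q.margin x y = k * P.margin x y := by
  classical
  obtain ⟨V, hV⟩ := Infinite.exists_subset_card_eq 𝓥 (k * P.voters.card)
  have e : V ≃ Fin k × P.voters := Fintype.equivOfCardEq (by simp [hV])
  refine ⟨⟨V, P.alts, fun i => if h : i ∈ V then P.pref (e ⟨i, h⟩).2 else fun _ _ => False,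
    ?_, P.alts_nonempty, ?_, ?_⟩, rfl, ?_⟩
  · rw [← Finset.card_pos, hV]
    exact Nat.mul_pos hk (Finset.card_pos.2 P.voters_nonempty)
  · intro i hi
    simpa [hi] using P.pref_weak _ (e ⟨i, hi⟩).2.2
  · intro i hi
    simp [hi]
  · intro x y
    rw [margin_eq_sum, margin_eq_sum]
    dsimp only
    rw [← Finset.sum_attach V, ← Finset.sum_attach P.voters]
    simp only [Finset.coe_mem, dite_true, Subtype.coe_eta]
    rw [← Finset.univ_eq_attach, ← Finset.univ_eq_attach,
      Equiv.sum_comp e (fun p => ballotMargin (P.pref p.2) x y), Fintype.sum_prod_type]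
    simp

/-- A linearly edge-ordered tournament is stable under rescaling and small perturbations of the
margins. -/
theorem ordinalMarginGraph_eq_of_near {P Q : Profile 𝓥 𝓧}
    (hP : P.ordinalMarginGraph.IsLinearlyEdgeOrderedTournament) (halts : Q.alts = P.alts)
    {T : ℝ} (hT : 0 < T)
    (h : ∀ x ∈ P.alts, ∀ y ∈ P.alts, |(Q.margin x y : ℝ) - T * P.margin x y| < T / 2) :
    Q.ordinalMarginGraph = P.ordinalMarginGraph := by
  have gap : ∀ {a b : ℤ}, a < b → T * a + T ≤ T * b := by
    intro a b hab
    have : (a : ℝ) + 1 ≤ b := by exact_mod_cast hab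
    nlinarith
  have pos_of_pos : ∀ x ∈ P.alts, ∀ y ∈ P.alts, 0 < P.margin x y → 0 < Q.margin x y := by
    intro x hx y hy hxy
    have h1 := abs_lt.1 (h x hx y hy)
    have h2 := gap hxy
    have : (0 : ℝ) < Q.margin x y := by push_cast at h2; linarith
    exact_mod_cast this
  have pos_iff : ∀ x ∈ P.alts, ∀ y ∈ P.alts, (0 < Q.margin x y ↔ 0 < P.margin x y) := by
    intro x hx y hy
    refine ⟨fun hxy => ?_, pos_of_pos x hx y hy⟩
    have hne : x ≠ y := by
      rintro rfl
      simp [margin_self] at hxy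
    -- Completeness gives the converse: otherwise the reversed edge would have positive margin in
    -- both profiles.
    rcases hP.complete x hx y hy hne with h1 | h1
    · exact h1.2.2
    · have h2 := pos_of_pos y hy x hx h1.2.2
      rw [margin_swap] at h2
      omega
  have lt_of_lt : ∀ x ∈ P.alts, ∀ y ∈ P.alts, ∀ z ∈ P.alts, ∀ t ∈ P.alts,
      P.margin x y < P.margin z t → Q.margin x y < Q.margin z t := by
    intro x hx y hy z hz t ht hlt
    have h1 := abs_lt.1 (h x hx y hy)
    have h2 := abs_lt.1 (h z hz t ht)
    have h3 := gap hlt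
    have : (Q.margin x y : ℝ) < Q.margin z t := by linarith
    exact_mod_cast this
  refine EdgeOrderedGraph.ext halts ?_ ?_
  · ext ⟨x, y⟩
    simp only [ordinalMarginGraph, halts, Set.mem_ofPred_eq]
    exact and_congr_right fun hx => and_congr_right fun hy => pos_iff x hx y hy
  · funext ⟨x, y⟩ ⟨z, t⟩
    simp only [ordinalMarginGraph, halts, eq_iff_iff]
    constructor
    · rintro ⟨⟨hx, hy, hxy⟩, ⟨hz, ht, hzt⟩, hlt⟩
      rw [pos_iff x hx y hy] at hxy
      rw [pos_iff z hz t ht] at hzt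
      have hne : (x, y) ≠ (z, t) := by
        rintro ⟨⟩
        exact lt_irrefl _ hlt
      -- No two edges tie in the linear order, so preserving strict comparisons also reflects them.
      rcases hP.linear.total (x, y) ⟨hx, hy, hxy⟩ (z, t) ⟨hz, ht, hzt⟩ hne with h1 | h1
      · exact h1
      · exact absurd (lt_of_lt x hx y hy z hz t ht h1.2.2) hlt.asymm
    · rintro ⟨⟨hx, hy, hxy⟩, ⟨hz, ht, hzt⟩, hlt⟩
      exact ⟨⟨hx, hy, (pos_iff x hx y hy).2 hxy⟩, ⟨hz, ht, (pos_iff z hz t ht).2 hzt⟩,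
        lt_of_lt z hz t ht x hx y hy hlt⟩

end Profile

/-! ### The single-voter case. -/

theorem VotingMethod.SingleVoterResolvable.card_winners_eq_one {𝓥 𝓧 : Type*} [Infinite 𝓥]
    {F : VotingMethod 𝓥 𝓧} (hres : F.SingleVoterResolvable) (hF : F.OrdinalMarginInvariant)
    {P : Profile 𝓥 𝓧} (hP : P.ordinalMarginGraph.IsLinearlyEdgeOrderedTournament) :
    (F.winners P).card = 1 := by
  by_contra hne
  have hpos := Finset.card_pos.2 (F.winners_nonempty P)
  -- Three is the least integer factor whose half strictly exceeds the change of 1 that a voter can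
  -- cause.
  obtain ⟨Q, hQalts, hQ⟩ := P.exists_margin_eq_mul (k := 3) (by norm_num)
  have hQP : F.winners Q = F.winners P := hF _ _ <|
    Profile.ordinalMarginGraph_eq_of_near hP hQalts (T := 3) (by norm_num) fun x _ y _ => by
      simp [hQ]
  obtain ⟨R, hR, hcard⟩ := hres Q (by rw [hQP]; omega)
  have hRP : F.winners R = F.winners P := hF _ _ <|
    Profile.ordinalMarginGraph_eq_of_near hP (hR.1.trans hQalts) (T := 3) (by norm_num)
      fun x _ y _ => by
        have h1 : |(R.margin x y : ℝ) - Q.margin x y| ≤ 1 := by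
          exact_mod_cast hR.abs_margin_sub_le x y
        rw [hQ] at h1
        push_cast at h1
        linarith
  exact hne (hRP ▸ hcard)

/-! ### Linear ballots and the margin functions they span. -/

/-- The linear ballots on a set of alternatives. -/
abbrev LinearBallot {𝓧 : Type*} (A : Finset 𝓧) :=
  {r : 𝓧 → 𝓧 → Prop // IsStrictLinearOrderOn (A : Set 𝓧) r}

namespace LinearBallot

variable {𝓧 : Type*} {A : Finset 𝓧}

instance : Finite (LinearBallot A) := by
  refine Finite.of_injective (fun (r : LinearBallot A) (x y : A) => r.1 x y) ?_
  intro r s h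
  refine Subtype.ext ?_
  funext x y
  by_cases hxy : x ∈ A ∧ y ∈ A
  · exact congrFun (congrFun h ⟨x, hxy.1⟩) ⟨y, hxy.2⟩
  · rw [eq_iff_iff]
    exact iff_of_false (fun h1 => hxy (r.2.mem x y h1)) (fun h1 => hxy (s.2.mem x y h1))

noncomputable instance : Fintype (LinearBallot A) := Fintype.ofFinite _

/-- The ballot that ranks alternatives by increasing values of a key. -/
def ofKey (A : Finset 𝓧) (k : 𝓧 → ℕ) (hk : Set.InjOn k A) : LinearBallot A :=
  ⟨fun x y => x ∈ A ∧ y ∈ A ∧ k x < k y, by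
    refine ⟨fun x y h => ⟨h.1, h.2.1⟩, fun x h => lt_irrefl _ h.2.2,
      fun x y z h1 h2 => ⟨h1.1, h2.2.1, h1.2.2.trans h2.2.2⟩, fun x hx y hy hxy => ?_⟩
    rcases lt_or_gt_of_ne (hk.ne hx hy hxy) with h | h
    · exact Or.inl ⟨hx, hy, h⟩
    · exact Or.inr ⟨hy, hx, h⟩⟩

theorem exists_key (A : Finset 𝓧) : ∃ k : 𝓧 → ℕ, Set.InjOn k A := by
  classical
  refine ⟨fun x => if h : x ∈ A then A.equivFin ⟨x, h⟩ else 0, ?_⟩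
  intro x hx y hy hxy
  have hx' : x ∈ A := hx
  have hy' : y ∈ A := hy
  simpa [hx', hy', Fin.val_inj] using hxy

instance : Nonempty (LinearBallot A) :=
  let ⟨k, hk⟩ := exists_key A
  ⟨ofKey A k hk⟩

/-- Reversal of a ballot. -/
def reverse : LinearBallot A ≃ LinearBallot A :=
  Function.Involutive.toPerm
    (fun r => ⟨fun x y => r.1 y x, fun x y h => (r.2.mem y x h).symm, r.2.irrefl,
      fun x y z h1 h2 => r.2.trans z y x h2 h1, fun x hx y hy h => (r.2.total x hx y hy h).symm⟩)
    (fun _ => rfl)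

/-- Reversal permutes the ballots and negates each contribution, so uniform ballots produce no
drift. -/
theorem sum_ballotMargin (x y : 𝓧) :
    ∑ r : LinearBallot A, (ballotMargin r.1 x y : ℝ) = 0 := by
  have h := Equiv.sum_comp (reverse (A := A)) fun r => (ballotMargin r.1 x y : ℝ)
  have h2 : ∀ r : LinearBallot A,
      (ballotMargin (reverse r).1 x y : ℝ) = -ballotMargin r.1 x y := fun r => by
    exact_mod_cast ballotMargin_flip r.1 x y
  simp_rw [h2, Finset.sum_neg_distrib] at h
  linarith

/-- Two ballots that differ exactly by a transposition of the top two alternatives. -/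
theorem exists_ballotMargin_sub_eq {a b : 𝓧} (ha : a ∈ A) (hb : b ∈ A) (hab : a ≠ b)
    [DecidableEq 𝓧] :
    ∃ r s : LinearBallot A, ∀ x ∈ A, ∀ y ∈ A, ballotMargin r.1 x y - ballotMargin s.1 x y =
      2 * ((if x = a ∧ y = b then 1 else 0) - (if x = b ∧ y = a then 1 else 0)) := by
  obtain ⟨k, hk⟩ := exists_key A
  have inj : ∀ a b : 𝓧, a ≠ b →
      Set.InjOn (fun x => if x = a then 0 else if x = b then 1 else k x + 2) A := by
    intro a b hab x hx y hy hxy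
    dsimp only at hxy
    split_ifs at hxy with h1 h2 h3 h4 h5 h6 h7
    all_goals first | omega | (subst_vars; rfl) | exact hk hx hy (by omega)
  refine ⟨ofKey A _ (inj a b hab), ofKey A _ (inj b a hab.symm), fun x hx y hy => ?_⟩
  by_cases hxa : x = a
  · by_cases hya : y = a
    · subst hxa hya
      simp [ballotMargin, ofKey, hab]
    · by_cases hyb : y = b
      · subst hxa hyb
        simp [ballotMargin, ofKey, hx, hy, hab, hab.symm]
      · subst hxa
        simp [ballotMargin, ofKey, hx, hy, hab, hya, hyb]
  · by_cases hxb : x = b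
    · by_cases hya : y = a
      · subst hxb hya
        simp [ballotMargin, ofKey, hx, hy, hab, hab.symm]
      · subst hxb
        by_cases hyb : y = x
        · subst hyb
          simp [ballotMargin, ofKey, hab.symm]
        · simp [ballotMargin, ofKey, hx, hy, hab.symm, hya, hyb]
    · by_cases hya : y = a
      · subst hya
        simp [ballotMargin, ofKey, hx, hy, hxa, hxb, hab]
      · by_cases hyb : y = b
        · subst hyb
          simp [ballotMargin, ofKey, hx, hy, hxa, hxb, hab.symm]
        · simp [ballotMargin, ofKey, hx, hy, hxa, hxb, hya, hyb]

/-- Every antisymmetric function is a margin function of some real weight on linear ballots, of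
total weight zero. -/
theorem exists_weight (d : 𝓧 → 𝓧 → ℝ) (hd : ∀ x y, d y x = -d x y) :
    ∃ w : LinearBallot A → ℝ, ∑ r, w r = 0 ∧
      ∀ x ∈ A, ∀ y ∈ A, ∑ r, w r * ballotMargin r.1 x y = d x y := by
  classical
  have basic : ∀ a b : A, ∃ w : LinearBallot A → ℝ, ∑ r, w r = 0 ∧
      ∀ x y : A, ∑ r, w r * ballotMargin r.1 x y =
        (if x = a ∧ y = b then 1 else 0) - (if x = b ∧ y = a then 1 else 0) := by
    rintro ⟨a, ha⟩ ⟨b, hb⟩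
    by_cases hab : a = b
    · subst hab
      exact ⟨0, by simp, by simp⟩
    · obtain ⟨r, s, hrs⟩ := exists_ballotMargin_sub_eq ha hb hab
      -- The swap of the top two alternatives changes only their mutual margin, by 2; hence weights
      -- `1 / 2` and `-1 / 2`.
      refine ⟨fun t => ((if t = r then 1 else 0) - (if t = s then 1 else 0)) / 2, ?_, ?_⟩
      · simp [← Finset.sum_div]
      · rintro ⟨x, hx⟩ ⟨y, hy⟩
        have h := hrs x hx y hy
        have h' : (ballotMargin r.1 x y : ℝ) - ballotMargin s.1 x y =
            2 * ((if x = a ∧ y = b then 1 else 0) - (if x = b ∧ y = a then 1 else 0)) := by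
          exact_mod_cast h
        simp only [div_mul_eq_mul_div, ← Finset.sum_div, sub_mul, ite_mul, one_mul, zero_mul,
          Finset.sum_sub_distrib, Finset.sum_ite_eq', Finset.mem_univ, if_true, Subtype.mk.injEq]
        rw [h']
        ring
  choose W hW0 hW using basic
  -- Ordered pairs count each unordered pair twice, hence the half.
  refine ⟨fun r => ∑ a : A, ∑ b : A, d a b / 2 * W a b r, ?_, ?_⟩
  · rw [Finset.sum_comm]
    refine Finset.sum_eq_zero fun a _ => ?_
    rw [Finset.sum_comm]
    refine Finset.sum_eq_zero fun b _ => ?_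
    rw [← Finset.mul_sum, hW0, mul_zero]
  · intro x hx y hy
    simp_rw [Finset.sum_mul]
    rw [Finset.sum_comm]
    have h1 : ∀ a : A, ∑ r, ∑ b : A, d a b / 2 * W a b r * (ballotMargin r.1 x y : ℝ) =
        ∑ b : A, d a b / 2 * ((if (⟨x, hx⟩ : A) = a ∧ (⟨y, hy⟩ : A) = b then 1 else 0) -
          (if (⟨x, hx⟩ : A) = b ∧ (⟨y, hy⟩ : A) = a then 1 else 0)) := by
      intro a
      rw [Finset.sum_comm]
      refine Finset.sum_congr rfl fun b _ => ?_
      rw [← hW a b ⟨x, hx⟩ ⟨y, hy⟩, Finset.mul_sum]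
      simp_rw [mul_assoc]
    simp_rw [h1, mul_sub, Finset.sum_sub_distrib, mul_ite, mul_one, mul_zero, ite_and]
    simp only [Finset.sum_ite_eq, Finset.mem_univ, if_true, Finset.sum_const_zero,
      Finset.sum_ite_irrel, hd x y]
    ring

end LinearBallot

theorem IsStrictLinearOrderOn.isStrictWeakOrderOn {α : Type*} {s : Set α}
    {r : α → α → Prop} (h : IsStrictLinearOrderOn s r) : IsStrictWeakOrderOn s r where
  mem := h.mem
  asymm x y hxy hyx := h.irrefl x (h.trans x y x hxy hyx)
  neg_trans x y z hz hxy := by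
    by_cases hxz : x = z
    · exact Or.inr (hxz ▸ hxy)
    · rcases h.total x (h.mem x y hxy).1 z hz hxz with h1 | h1
      · exact Or.inl h1
      · exact Or.inr (h.trans z x y h1 hxy)

/-! ### Linear profiles as samples of ballots. -/

namespace Profile

variable {𝓥 𝓧 : Type*}

/-- The linear profile with given linear ballots. -/
def ofBallots {V : Finset 𝓥} {A : Finset 𝓧} (hV : V.Nonempty) (hA : A.Nonempty)
    (f : V → LinearBallot A) : Profile 𝓥 𝓧 where
  voters := V
  alts := A
  pref i x y := ∃ h : i ∈ V, (f ⟨i, h⟩).1 x y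
  voters_nonempty := hV
  alts_nonempty := hA
  pref_weak i hi := by simpa [hi] using (f ⟨i, hi⟩).2.isStrictWeakOrderOn
  pref_off i hi := by simp [hi]

section OfBallots

variable {V : Finset 𝓥} {A : Finset 𝓧} (hV : V.Nonempty) (hA : A.Nonempty)

theorem ofBallots_pref (f : V → LinearBallot A) (i : V) :
    (ofBallots hV hA f).pref i = (f i).1 := by
  funext x y
  simp [ofBallots]

theorem ofBallots_injective : Function.Injective (ofBallots (𝓥 := 𝓥) hV hA) := by
  intro f g h
  funext i
  rw [Subtype.ext_iff, ← ofBallots_pref hV hA f i, h, ofBallots_pref]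

theorem range_ofBallots : Set.range (ofBallots (𝓥 := 𝓥) hV hA) = linearProfiles V A := by
  ext P
  constructor
  · rintro ⟨f, rfl⟩
    refine ⟨rfl, rfl, fun i hi => ?_⟩
    have : (ofBallots hV hA f).pref i = (f ⟨i, hi⟩).1 := ofBallots_pref hV hA f ⟨i, hi⟩
    rw [this]
    exact (f ⟨i, hi⟩).2
  · rintro ⟨rfl, rfl, hlin⟩
    refine ⟨fun i => ⟨P.pref i, hlin i i.2⟩, Profile.ext rfl rfl ?_⟩
    funext i x y
    by_cases hi : i ∈ P.voters
    · simp [ofBallots, hi]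
    · simp [ofBallots, hi, P.pref_off i hi]

theorem margin_ofBallots (f : V → LinearBallot A) (x y : 𝓧) :
    (ofBallots hV hA f).margin x y = ∑ i, ballotMargin (f i).1 x y := by
  have h : ∀ i : V, ballotMargin (f i).1 x y =
      ballotMargin ((ofBallots hV hA f).pref i) x y := fun i => by rw [ofBallots_pref]
  simp_rw [margin_eq_sum, h]
  exact (Finset.sum_coe_sort V fun i => ballotMargin ((ofBallots hV hA f).pref i) x y).symm

theorem ncard_linearProfiles (hV : V.Nonempty) (hA : A.Nonempty) :
    (linearProfiles V A).ncard = Fintype.card (LinearBallot A) ^ Fintype.card V := by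
  classical
  rw [← range_ofBallots hV hA, ← Set.image_univ,
    Set.ncard_image_of_injective _ (ofBallots_injective hV hA), Set.ncard_univ,
    Nat.card_eq_fintype_card, Fintype.card_fun]

end OfBallots

/-- For large sets of voters, a linearly edge-ordered tournament is the ordinal margin graph of a
share of the linear profiles that is bounded below. -/
theorem exists_le_ncard_ordinalMarginGraph_eq {P : Profile 𝓥 𝓧}
    (hP : P.ordinalMarginGraph.IsLinearlyEdgeOrderedTournament) :
    ∃ c : ℝ, 0 < c ∧ ∃ n₀ : ℕ, ∀ V : Finset 𝓥, n₀ ≤ V.card →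
      0 < (linearProfiles V P.alts).ncard ∧ c * (linearProfiles V P.alts).ncard ≤
        {Q ∈ linearProfiles V P.alts | Q.ordinalMarginGraph = P.ordinalMarginGraph}.ncard := by
  classical
  set A := P.alts with hA
  obtain ⟨w, hw0, hw⟩ := LinearBallot.exists_weight (A := A)
    -- The number of ballots undoes the normalisation of the uniform measure, so the drift is along
    -- the margins of `P` themselves.
    (fun x y => Fintype.card (LinearBallot A) * (P.margin x y : ℝ))
    (fun x y => by rw [P.margin_swap]; push_cast; ring)
  obtain ⟨c, hc, n₀, h⟩ := exists_le_card_near_drift (κ := A × A)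
    (fun p (r : LinearBallot A) => (ballotMargin r.1 p.1 p.2 : ℝ)) (fun p => P.margin p.1 p.2) w
    (fun p r => by exact_mod_cast abs_ballotMargin_le r.1 p.1 p.2)
    (fun p => LinearBallot.sum_ballotMargin _ _) hw0 (fun p => hw _ p.1.2 _ p.2.2)
  refine ⟨c, hc, n₀ + 1, fun V hV => ?_⟩
  have hVne : V.Nonempty := Finset.card_pos.1 (by omega)
  have hAne : A.Nonempty := P.alts_nonempty
  obtain ⟨T, hT, hle⟩ := h V (by rw [Fintype.card_coe]; omega)
  rw [ncard_linearProfiles hVne hAne]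
  refine ⟨pow_pos Fintype.card_pos _, ?_⟩
  push_cast
  refine hle.trans ?_
  rw [Nat.cast_le, ← Set.ncard_image_of_injective _ (ofBallots_injective hVne hAne)]
  refine Set.ncard_le_ncard ?_ ((finite_linearProfiles V A).subset (Set.sep_subset _ _))
  rintro _ ⟨f, hf, rfl⟩
  refine ⟨range_ofBallots hVne hAne ▸ Set.mem_range_self f,
    ordinalMarginGraph_eq_of_near hP rfl hT fun x hx y hy => ?_⟩
  rw [margin_ofBallots]
  push_cast
  exact hf (⟨x, hx⟩, ⟨y, hy⟩)

end Profile

/-! ### The asymptotic case. -/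

theorem VotingMethod.AsymptoticallyResolvable.card_winners_eq_one {𝓥 𝓧 : Type*} [Infinite 𝓥]
    {F : VotingMethod 𝓥 𝓧} (hres : F.AsymptoticallyResolvable) (hF : F.OrdinalMarginInvariant)
    {P : Profile 𝓥 𝓧} (hP : P.ordinalMarginGraph.IsLinearlyEdgeOrderedTournament) :
    (F.winners P).card = 1 := by
  by_contra hne
  have hpos := Finset.card_pos.2 (F.winners_nonempty P)
  obtain ⟨c, hc, n₀, h⟩ := Profile.exists_le_ncard_ordinalMarginGraph_eq hP
  have htend := hres _ (Finset.card_pos.2 P.alts_nonempty) P.alts rfl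
  obtain ⟨N, hN⟩ := (eventually_atTop.1 (eventually_comap.1 (htend.eventually_lt_const hc)))
  -- A set of voters this large has tie proportion below `c`, while profiles sharing the graph of
  -- `P`, all tied, already make up a share `c`.
  obtain ⟨V, hV⟩ := Infinite.exists_subset_card_eq 𝓥 (max n₀ N)
  have hlt := hN _ (le_max_right n₀ N) V hV
  obtain ⟨hcard, hle⟩ := h V (hV ▸ le_max_left n₀ N)
  rw [VotingMethod.tieProportion, div_lt_iff₀ (by exact_mod_cast hcard)] at hlt
  refine hlt.not_ge (hle.trans ?_)
  rw [Nat.cast_le]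
  refine Set.ncard_le_ncard ?_
    ((Profile.finite_linearProfiles V P.alts).subset (Set.sep_subset _ _))
  rintro Q ⟨hQ, hQP⟩
  refine ⟨hQ, ?_⟩
  rw [hF Q P hQP]
  omega

end SocialChoice

theorem lemma2 {𝓥 𝓧 : Type*} [Infinite 𝓥] [Infinite 𝓧]
    (F : SocialChoice.VotingMethod 𝓥 𝓧) (hF : F.OrdinalMarginInvariant) :
    (F.SingleVoterResolvable →
      ∀ P : SocialChoice.Profile 𝓥 𝓧,
        P.ordinalMarginGraph.IsLinearlyEdgeOrderedTournament → ∃ x, F.winners P = {x}) ∧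
    (F.AsymptoticallyResolvable →
      ∀ P : SocialChoice.Profile 𝓥 𝓧,
        P.ordinalMarginGraph.IsLinearlyEdgeOrderedTournament → ∃ x, F.winners P = {x}) :=
  ⟨fun h _ hP => Finset.card_eq_one.1 (h.card_winners_eq_one hF hP),
    fun h _ hP => Finset.card_eq_one.1 (h.card_winners_eq_one hF hP)⟩
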